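/- Let $\pi$ and $q$ be probability measures on a measurable space $(\mathbb{X},\mathcal{X})$ with $\pi$ absolutely continuous with respect to $q$, and let $\omega=\mathrm{d}\pi/\mathrm{d}q$ (so $q(\omega)=1$), with $\omega>0$ $q$-almost surely. Assume that $q(\omega^p)<\infty$ for some real $p\ge 2$. For $N\ge 1$, let $\bar q=q^{\otimes N}$ on $\mathbb{X}^N$ and $\hat Z(\mathbf{x})=N^{-1}\sum_{n=1}^N\omega(x_n)$. For $\mathbf{x},\mathbf{x}^\star\in\mathbb{X}^N$ and $u\in(0,1)$, let $\Phi(\mathbf{x},\mathbf{x}^\star,u)=\mathbf{x}^\star$ if $u<\hat Z(\mathbf{x}^\star)/\hat Z(\mathbf{x})$, and $\Phi(\mathbf{x},\mathbf{x}^\star,u)=\mathbf{x}$ otherwise. Draw $\mathbf{x}_0,\mathbf{y}_0\sim\bar q$, $u_0\sim\mathrm{Uniform}(0,1)$ and, for $t\ge 1$, $\mathbf{x}^\star_t\sim\bar q$ and $u_t\sim\mathrm{Uniform}(0,1)$, all independent. The lagged coupled particle independent Metropolis--Hastings (PIMH) chains are defined by $$\mathbf{x}_1=\Phi(\mathbf{x}_0,\mathbf{y}_0,u_0),\qquad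 \mathbf{x}_{t+1}=\Phi(\mathbf{x}_t,\mathbf{x}^\star_t,u_t),\qquad \mathbf{y}_t=\Phi(\mathbf{y}_{t-1},\mathbf{x}^\star_t,u_t)\qquad(t\ge 1),$$ and their meeting time is $\tau=\inf\{t\ge 1:\mathbf{x}_t=\mathbf{y}_{t-1}\}\in\{1,2,\dots\}\cup\{\infty\}$. Then there exists a finite constant $C>0$ such that, for all $N\ge 1$, $$\mathbb{P}(\tau>t)\le\frac{C}{\sqrt N\,t^p}\quad\text{for all integers } t\ge 1,\qquad\text{and}\qquad \mathbb{E}[\tau]\le 1+\frac{C'}{\sqrt N}\quad\text{with}\quad C'=C\sum_{t\ge 1}t^{-p}.$$ -/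

import Mathlib

open MeasureTheory ProbabilityTheory
open scoped ENNReal

noncomputable section

namespace PIMH

variable {X : Type*} {N : ℕ}

/-- The average weight `Ẑ(x₁, …, x_N) = N⁻¹ ∑ₙ w(xₙ)`. -/
def Zhat (w : X → ℝ) (x : Fin N → X) : ℝ :=
  (N : ℝ)⁻¹ * ∑ n, w (x n)

open Classical in
/-- One PIMH update of the state `x`, given the proposal `xs` and the uniform draw `u`:
accept `xs` when `u < Ẑ(xs) / Ẑ(x)`, and otherwise stay at `x`. -/
def step (w : X → ℝ) (x xs : Fin N → X) (u : ℝ) : Fin N → X :=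
  if u < Zhat w xs / Zhat w x then xs else x

/-- One step of the common draws coupling: both chains use the same proposal and the same
uniform draw. -/
def coupledStep (w : X → ℝ) (s : (Fin N → X) × (Fin N → X)) (xs : Fin N → X) (u : ℝ) :
    (Fin N → X) × (Fin N → X) :=
  (step w s.1 xs u, step w s.2 xs u)

/-- All the draws made by the lagged algorithm: the initial states `x₀` and `y₀`, the uniform
used in the first update of the `x`-chain (whose proposal is `y₀`), and then, for each
subsequent iteration, a proposal in `X^N` together with a uniform draw. -/
abbrev Draws (X : Type*) (N : ℕ) : Type _ :=
  (Fin N → X) × (Fin N → X) × ℝ × (ℕ → (Fin N → X) × ℝ)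

/-- The pair `(x_{n+1}, y_n)` of the lagged chains, as a function of the draws. -/
def lagChain (w : X → ℝ) (d : Draws X N) : ℕ → (Fin N → X) × (Fin N → X)
  | 0 => (step w d.1 d.2.1 d.2.2.1, d.2.1)
  | n + 1 => coupledStep w (lagChain w d n) (d.2.2.2 n).1 (d.2.2.2 n).2

/-- The meeting time `τ = inf {t ≥ 1 : x_t = y_{t-1}}`, with `inf ∅ = ∞`. -/
def meetingTime (w : X → ℝ) (d : Draws X N) : ℕ∞ :=
  sInf {τ : ℕ∞ | ∃ n : ℕ, τ = ((n + 1 : ℕ) : ℕ∞) ∧ (lagChain w d n).1 = (lagChain w d n).2}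

/-- The uniform distribution on `(0, 1)`. -/
def unif : Measure ℝ := volume.restrict (Set.Ioo 0 1)

instance : IsProbabilityMeasure unif :=
  ⟨by simp [unif]⟩

variable [MeasurableSpace X]

/-- The law `q̄` of `N` independent particles, each distributed according to `q`. -/
def qbar (q : Measure X) (N : ℕ) : Measure (Fin N → X) := Measure.pi fun _ => q

instance (q : Measure X) [IsProbabilityMeasure q] : IsProbabilityMeasure (qbar q N) := by
  unfold qbar; infer_instance

/-- The joint law of the draws: all of them are independent, the elements of `X^N` are
distributed according to `q̄`, and the real numbers are uniform on `(0, 1)`. -/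
def drawLaw (q : Measure X) [IsProbabilityMeasure q] (N : ℕ) : Measure (Draws X N) :=
  (qbar q N).prod ((qbar q N).prod
    (unif.prod (Measure.infinitePi fun _ : ℕ => (qbar q N).prod unif)))

instance (q : Measure X) [IsProbabilityMeasure q] : IsProbabilityMeasure (drawLaw q N) := by
  unfold drawLaw; infer_instance

end PIMH

end

/-! ### Inequalities for real powers. -/

namespace PIMH

/-! Until the chains meet, the leading chain sits at `x₀` and the other has no larger `Zhat`, so any
proposal accepted by the leader is accepted by both and they meet. Hence `τ > t` forces `x₀` to
reject `t` proposals that are i.i.d. given `x₀` (`mem_rejections_of_not_met`, `drawLaw_rejections`),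
and `P(τ > t) ≤ E[r(x₀)^t]`, where `r` is the rejection probability.

Put `c = q(min(w, 1)) > 0`. Two estimates are combined: `r ≤ 1 - c / max(Zhat, 1)` pointwise, and
`E[r] ≤ 4 E|Zhat - 1| = O(1/√N)`. Where `Zhat ≤ 2`, one factor `r` supplies `1/√N` and the others
decay geometrically. Where `Zhat ≥ 2`, `(1 - c / Zhat)^t` is at most a constant times `(Zhat - 1)^p
/ t^p`, and `E[(Zhat - 1)₊^p] = O(1/N)` by a leave-one-out argument. Summing the tails bounds
`E[τ]`. -/

theorem rpow_mul_rpow_le_add {a b s r : ℝ} (ha : 0 ≤ a) (hb : 0 ≤ b) (hs : 0 ≤ s) (hr : 0 ≤ r) :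
    a ^ s * b ^ r ≤ a ^ (s + r) + b ^ (s + r) := by
  rw [Real.rpow_add_of_nonneg ha hs hr, Real.rpow_add_of_nonneg hb hs hr]
  rcases le_total a b with h | h
  · have := mul_le_mul_of_nonneg_right (Real.rpow_le_rpow ha h hs) (Real.rpow_nonneg hb r)
    have : 0 ≤ a ^ s * a ^ r := by positivity
    linarith
  · have := mul_le_mul_of_nonneg_left (Real.rpow_le_rpow hb h hr) (Real.rpow_nonneg ha s)
    have : 0 ≤ b ^ s * b ^ r := by positivity
    linarith

/-- Bernoulli's inequality at `b / a`, rescaled by `a ^ r`. -/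
theorem rpow_sub_rpow_le {a b r : ℝ} (hb : 0 ≤ b) (hab : b ≤ a) (hr : 1 ≤ r) :
    a ^ r - b ^ r ≤ r * (a - b) * a ^ (r - 1) := by
  rcases (hb.trans hab).eq_or_lt with ha | ha
  · obtain rfl : b = a := le_antisymm hab (ha ▸ hb)
    simp
  · have h := one_add_mul_self_le_rpow_one_add (s := b / a - 1)
      (by have := div_nonneg hb ha.le; linarith) hr
    have h1 : 1 + (b / a - 1) = b / a := by ring
    rw [h1, Real.div_rpow hb ha.le, le_div_iff₀ (by positivity)] at h
    have h2 : a ^ r = a * a ^ (r - 1) := by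
      rw [← Real.rpow_one_add' ha.le (by linarith)]; congr 1; ring
    have h3 : (1 + r * (b / a - 1)) * a ^ r = a ^ r - r * (a - b) * a ^ (r - 1) := by
      rw [h2]; field_simp; ring
    linarith

theorem abs_posPart_rpow_sub_le {x y m r : ℝ} (hx : |x| ≤ m) (hy : |y| ≤ m) (hr : 1 ≤ r) :
    |max x 0 ^ r - max y 0 ^ r| ≤ r * |x - y| * m ^ (r - 1) := by
  wlog hxy : y ≤ x generalizing x y
  · rw [abs_sub_comm, abs_sub_comm x]
    exact this hy hx (le_of_not_ge hxy)
  have h0 : max y 0 ≤ max x 0 := max_le_max_right 0 hxy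
  have hm : 0 ≤ m := (abs_nonneg x).trans hx
  have h1 := Real.rpow_le_rpow (le_max_right y 0) h0 (by linarith : 0 ≤ r)
  rw [abs_of_nonneg (by linarith)]
  refine (rpow_sub_rpow_le (le_max_right y 0) h0 hr).trans ?_
  have h2 : max x 0 - max y 0 ≤ |x - y| :=
    (le_abs_self _).trans (abs_max_sub_max_le_abs x y 0)
  have h3 : max x 0 ≤ m := max_le ((le_abs_self x).trans hx) hm
  have h4 : max x 0 ^ (r - 1) ≤ m ^ (r - 1) :=
    Real.rpow_le_rpow (le_max_right x 0) h3 (by linarith)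
  have h5 : 0 ≤ max x 0 ^ (r - 1) := Real.rpow_nonneg (le_max_right x 0) _
  gcongr

/-! ### Moments of averages of independent centred variables. -/

variable {X : Type*} {N : ℕ}

theorem Zhat_nonneg {g : X → ℝ} {x : Fin N → X} (hg : ∀ n, 0 ≤ g (x n)) : 0 ≤ Zhat g x :=
  mul_nonneg (by positivity) (Finset.sum_nonneg fun n _ => hg n)

theorem Zhat_mono {f g : X → ℝ} {x : Fin N → X} (h : ∀ n, f (x n) ≤ g (x n)) :
    Zhat f x ≤ Zhat g x :=
  mul_le_mul_of_nonneg_left (Finset.sum_le_sum fun n _ => h n) (by positivity)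

theorem abs_Zhat_le (f : X → ℝ) (x : Fin N → X) : |Zhat f x| ≤ Zhat (fun y => |f y|) x := by
  unfold Zhat
  rw [abs_mul, abs_of_nonneg (by positivity : (0 : ℝ) ≤ (N : ℝ)⁻¹)]
  exact mul_le_mul_of_nonneg_left (Finset.abs_sum_le_sum_abs _ _) (by positivity)

theorem Zhat_rpow_le (hN : 1 ≤ N) {g : X → ℝ} (hg : ∀ y, 0 ≤ g y) {p : ℝ} (hp : 1 ≤ p)
    (x : Fin N → X) : Zhat g x ^ p ≤ Zhat (fun y => g y ^ p) x := by
  have hN' : (N : ℝ) ≠ 0 := by positivity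
  unfold Zhat
  rw [Finset.mul_sum, Finset.mul_sum]
  exact Real.rpow_arith_mean_le_arith_mean_rpow _ _ _ (fun _ _ => by positivity)
    (by simp [hN']) (fun i _ => hg _) hp

theorem Zhat_sub_one (hN : 1 ≤ N) (w : X → ℝ) (x : Fin N → X) :
    Zhat (fun y => w y - 1) x = Zhat w x - 1 := by
  have hN' : (N : ℝ) ≠ 0 := by positivity
  simp [Zhat, Finset.sum_sub_distrib, mul_sub, hN']

variable [MeasurableSpace X]

@[fun_prop]
theorem measurable_Zhat {w : X → ℝ} (hw : Measurable w) :
    Measurable (Zhat w : (Fin N → X) → ℝ) := by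
  unfold Zhat; fun_prop

theorem measurePreserving_eval_qbar (q : Measure X) [IsProbabilityMeasure q] (n : Fin N) :
    MeasurePreserving (fun x => x n) (qbar q N) q :=
  measurePreserving_eval (fun _ : Fin N => q) n

theorem integrable_eval_qbar {q : Measure X} [IsProbabilityMeasure q] {g : X → ℝ}
    (hg : Integrable g q) (n : Fin N) : Integrable (fun x => g (x n)) (qbar q N) :=
  integrable_comp_eval (μ := fun _ : Fin N => q) hg

theorem integral_eval_qbar {q : Measure X} [IsProbabilityMeasure q] {g : X → ℝ}
    (hg : Integrable g q) (n : Fin N) : ∫ x, g (x n) ∂(qbar q N) = ∫ y, g y ∂q :=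
  integral_comp_eval (μ := fun _ : Fin N => q) hg.aestronglyMeasurable

theorem integrable_Zhat {q : Measure X} [IsProbabilityMeasure q] {g : X → ℝ}
    (hg : Integrable g q) : Integrable (Zhat g) (qbar q N) := by
  refine Integrable.const_mul (integrable_finsetSum _ fun n _ => ?_) _
  exact integrable_eval_qbar hg n

theorem integral_Zhat {q : Measure X} [IsProbabilityMeasure q] (hN : 1 ≤ N) {g : X → ℝ}
    (hg : Integrable g q) : ∫ x, Zhat g x ∂(qbar q N) = ∫ y, g y ∂q := by
  have hN' : (N : ℝ) ≠ 0 := by positivity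
  unfold Zhat
  rw [integral_const_mul, integral_finsetSum _ fun n _ => integrable_eval_qbar hg n]
  simp [integral_eval_qbar hg, hN']

/-- A centred variable multiplied by a function of the other coordinates integrates to zero. -/
theorem integral_mul_comp_sum_erase {q : Measure X} [IsProbabilityMeasure q] {f : X → ℝ}
    (hf : Measurable f) (hf0 : ∫ y, f y ∂q = 0) {ψ : ℝ → ℝ} (hψ : Measurable ψ) (n : Fin N) :
    ∫ x, f (x n) * ψ (∑ i ∈ Finset.univ.erase n, f (x i)) ∂(qbar q N) = 0 := by
  have hind : iIndepFun (fun (i : Fin N) (x : Fin N → X) => f (x i)) (qbar q N) :=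
    iIndepFun_pi (μ := fun _ : Fin N => q) (X := fun _ => f) fun _ => hf.aemeasurable
  have h1 := (hind.indepFun_finsetSum_of_notMem (fun i => by fun_prop)
    (Finset.notMem_erase n Finset.univ)).symm
  have h2 := h1.comp measurable_id hψ
  have h3 := h2.integral_fun_mul_eq_mul_integral
    (hf.comp (measurable_pi_apply n)).aestronglyMeasurable
    (hψ.comp (by fun_prop)).aestronglyMeasurable
  have h4 : ∫ x, f (x n) ∂(qbar q N) = ∫ y, f y ∂q :=
    integral_comp_eval (μ := fun _ : Fin N => q) hf.aestronglyMeasurable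
  simpa [Function.comp_def, h4, hf0, Finset.sum_apply] using h3

/-- The positive part of an average of `N` centred variables has `p`-th moment `O(1 / N)`. -/
theorem integrable_and_integral_posPart_rpow_le {q : Measure X} [IsProbabilityMeasure q]
    (hN : 1 ≤ N) {f : X → ℝ}
    (hf : Measurable f) (hf0 : ∫ y, f y ∂q = 0) {p : ℝ} (hp : 2 ≤ p)
    (hfp : Integrable (fun y => |f y| ^ p) q) :
    Integrable (fun x => max (Zhat f x) 0 ^ p) (qbar q N) ∧
    ∫ x, max (Zhat f x) 0 ^ p ∂(qbar q N) ≤ 2 * (p - 1) * (∫ y, |f y| ^ p ∂q) / N := by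
  have hN' : (0 : ℝ) < N := by positivity
  set D := ∫ y, |f y| ^ p ∂q with hD
  set M : (Fin N → X) → ℝ := Zhat (fun y => |f y|) with hM
  have hM0 (x) : 0 ≤ M x := Zhat_nonneg fun n => abs_nonneg _
  have hMm : Measurable M := by fun_prop
  have hMp (x) : M x ^ p ≤ Zhat (fun y => |f y| ^ p) x :=
    Zhat_rpow_le hN (fun y => abs_nonneg _) (by linarith) x
  set A : (Fin N → X) → ℝ := Zhat f with hA
  -- Leave-one-out average: independent of coordinate `n`, and within `|f (x n)| / N` of `A`.
  set B : Fin N → (Fin N → X) → ℝ :=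
    fun n x => (N : ℝ)⁻¹ * ∑ i ∈ Finset.univ.erase n, f (x i) with hB
  have hAm : Measurable A := by fun_prop
  have hBm (n) : Measurable (B n) := by fun_prop
  have hAM (x) : |A x| ≤ M x := abs_Zhat_le f x
  have hBM (n x) : |B n x| ≤ M x := by
    simp only [hB, hM, Zhat]
    rw [abs_mul, abs_of_pos (by positivity : (0 : ℝ) < (N : ℝ)⁻¹)]
    refine mul_le_mul_of_nonneg_left ((Finset.abs_sum_le_sum_abs _ _).trans ?_) (by positivity)
    exact Finset.sum_le_sum_of_subset_of_nonneg (Finset.erase_subset _ _)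
      fun _ _ _ => abs_nonneg _
  have hAB (n x) : A x - B n x = (N : ℝ)⁻¹ * f (x n) := by
    simp only [hA, hB, Zhat]
    rw [← Finset.add_sum_erase _ _ (Finset.mem_univ n)]; ring
  -- the dominating function
  set G : Fin N → (Fin N → X) → ℝ := fun n x => |f (x n)| ^ p + Zhat (fun y => |f y| ^ p) x with hG
  have hGi (n) : Integrable (G n) (qbar q N) :=
    (integrable_eval_qbar hfp n).add (integrable_Zhat hfp)
  have hGint (n) : ∫ x, G n x ∂(qbar q N) = 2 * D := by
    have h1 : ∫ x, |f (x n)| ^ p ∂(qbar q N) = D := integral_eval_qbar hfp n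
    simp only [hG]
    rw [integral_add (integrable_eval_qbar hfp n) (integrable_Zhat hfp), integral_Zhat hN hfp, h1]
    ring
  have hdom (n x) {s r : ℝ} (hs : 0 ≤ s) (hr : 0 ≤ r) (hsr : s + r = p) :
      |f (x n)| ^ s * M x ^ r ≤ G n x := by
    refine (rpow_mul_rpow_le_add (abs_nonneg _) (hM0 x) hs hr).trans ?_
    rw [hsr]
    exact add_le_add_right (hMp x) _
  have hint (n) (C : (Fin N → X) → ℝ) (hC : Measurable C) (hCM : ∀ x, |C x| ≤ M x) :
      Integrable (fun x => f (x n) * max (C x) 0 ^ (p - 1)) (qbar q N) := by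
    refine (hGi n).mono' (Measurable.aestronglyMeasurable (by fun_prop)) (ae_of_all _ fun x => ?_)
    rw [Real.norm_eq_abs, abs_mul, abs_of_nonneg (Real.rpow_nonneg (le_max_right (C x) 0) _)]
    refine le_trans ?_ (hdom n x zero_le_one (by linarith : 0 ≤ p - 1) (by ring))
    rw [Real.rpow_one]
    refine mul_le_mul_of_nonneg_left (Real.rpow_le_rpow (le_max_right _ _) ?_ (by linarith))
      (abs_nonneg _)
    exact max_le ((le_abs_self _).trans (hCM x)) (hM0 x)
  have hzero (n) : ∫ x, f (x n) * max (B n x) 0 ^ (p - 1) ∂(qbar q N) = 0 :=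
    integral_mul_comp_sum_erase hf hf0 (ψ := fun s => max ((N : ℝ)⁻¹ * s) 0 ^ (p - 1))
      (by fun_prop) n
  -- Replacing `A` by `B n` makes the integral vanish; the replacement error carries the factor `1 /
  -- N`.
  have hn (n) : ∫ x, f (x n) * max (A x) 0 ^ (p - 1) ∂(qbar q N) ≤ (p - 1) / N * (2 * D) := by
    have h0 := integral_sub (hint n A hAm hAM) (hint n (B n) (hBm n) (hBM n))
    rw [hzero n, sub_zero] at h0
    rw [← h0, ← hGint n, ← integral_const_mul]
    refine integral_mono ((hint n A hAm hAM).sub (hint n (B n) (hBm n) (hBM n)))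
      ((hGi n).const_mul _) fun x => ?_
    have h1 := abs_posPart_rpow_sub_le (hAM x) (hBM n x) (by linarith : 1 ≤ p - 1)
    rw [hAB, abs_mul, abs_of_pos (by positivity : (0 : ℝ) < (N : ℝ)⁻¹)] at h1
    have h2 := hdom n x zero_le_two (by linarith : 0 ≤ p - 1 - 1) (by ring)
    rw [Real.rpow_two] at h2
    calc f (x n) * max (A x) 0 ^ (p - 1) - f (x n) * max (B n x) 0 ^ (p - 1)
        ≤ |f (x n)| * |max (A x) 0 ^ (p - 1) - max (B n x) 0 ^ (p - 1)| := by
          rw [← mul_sub, ← abs_mul]; exact le_abs_self _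
      _ ≤ |f (x n)| * ((p - 1) * ((N : ℝ)⁻¹ * |f (x n)|) * M x ^ (p - 1 - 1)) := by gcongr
      _ = (p - 1) / N * (|f (x n)| ^ 2 * M x ^ (p - 1 - 1)) := by ring
      _ ≤ (p - 1) / N * G n x := by
          have : 0 ≤ p - 1 := by linarith
          gcongr
  -- Only one of the `p` powers of the average is expanded as a sum, which leaves each `f (x n)`
  -- against a power of `A`.
  have hrep (x) : max (A x) 0 ^ p = (N : ℝ)⁻¹ * ∑ n, f (x n) * max (A x) 0 ^ (p - 1) := by
    rw [← Finset.sum_mul, ← mul_assoc]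
    change _ = A x * _
    rcases le_total (A x) 0 with h | h
    · rw [max_eq_right h, Real.zero_rpow (by linarith), Real.zero_rpow (by linarith), mul_zero]
    · rw [max_eq_left h, ← Real.rpow_one_add' h (by linarith)]; congr 1; ring
  simp_rw [hrep]
  refine ⟨(integrable_finsetSum _ fun n _ => hint n A hAm hAM).const_mul _, ?_⟩
  rw [integral_const_mul, integral_finsetSum _ fun n _ => hint n A hAm hAM]
  calc (N : ℝ)⁻¹ * ∑ n, ∫ x, f (x n) * max (A x) 0 ^ (p - 1) ∂(qbar q N)
      ≤ (N : ℝ)⁻¹ * ∑ n : Fin N, (p - 1) / N * (2 * D) := by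
        gcongr with n; exact hn n
    _ = 2 * (p - 1) * D / N := by
        simp; field_simp

/-- The average of `N` centred square-integrable variables has mean absolute value
`O(1 / √N)`. -/
theorem integral_abs_Zhat_le {q : Measure X} [IsProbabilityMeasure q]
    (hN : 1 ≤ N) {f : X → ℝ}
    (hf : MemLp f 2 q) (hf0 : ∫ y, f y ∂q = 0) :
    ∫ x, |Zhat f x| ∂(qbar q N) ≤ ((Var[f; q] + 1) / 2) / √N := by
  have hN' : (0 : ℝ) < N := by positivity
  have hs : 0 < √(N : ℝ) := Real.sqrt_pos.2 hN'
  have hss : √(N : ℝ) * √(N : ℝ) = N := Real.mul_self_sqrt hN'.le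
  have hfi : Integrable f q := hf.integrable (by norm_num)
  have hZ : MemLp (Zhat f) 2 (qbar q N) := by
    have hn (n : Fin N) : MemLp (fun x : Fin N → X => f (x n)) 2 (qbar q N) :=
      hf.comp_measurePreserving (measurePreserving_eval_qbar q n)
    have hsum : MemLp (fun x : Fin N → X => ∑ n, f (x n)) 2 (qbar q N) :=
      memLp_finsetSum (f := fun (n : Fin N) (x : Fin N → X) => f (x n)) Finset.univ
        fun n _ => hn n
    exact hsum.const_mul _
  have hvar : ∫ x, Zhat f x ^ 2 ∂(qbar q N) = Var[f; q] / N := by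
    have h1 : Var[Zhat f; qbar q N] = ∫ x, Zhat f x ^ 2 ∂(qbar q N) :=
      variance_of_integral_eq_zero hZ.aestronglyMeasurable.aemeasurable
        (by rw [integral_Zhat hN hfi, hf0])
    have h2 : Var[∑ i, fun x : Fin N → X => f (x i); qbar q N] = ∑ _i : Fin N, Var[f; q] :=
      variance_sum_pi (μ := fun _ : Fin N => q) (X := fun _ => f) fun _ => hf
    have h3 : (Zhat f : (Fin N → X) → ℝ) = fun x => (N : ℝ)⁻¹ * (∑ i, fun ω : Fin N → X => f (ω i)) x := by
      ext x; simp [Zhat, Finset.sum_apply]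
    rw [← h1, h3, variance_const_mul]
    rw [h2]; simp; field_simp
  -- AM-GM weighted by `√N`, so that both terms have mean of order `1 / √N`.
  have hb (x : Fin N → X) : |Zhat f x| ≤ √N / 2 * Zhat f x ^ 2 + (1 / 2) / √N := by
    rw [← sub_nonneg]
    have : √N / 2 * Zhat f x ^ 2 + (1 / 2) / √N - |Zhat f x|
        = (√N * |Zhat f x| - 1) ^ 2 / (2 * √N) := by
      rw [← sq_abs (Zhat f x)]; field_simp; ring
    rw [this]; positivity
  have h2i : Integrable (fun x => Zhat f x ^ 2) (qbar q N) := hZ.integrable_sq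
  calc ∫ x, |Zhat f x| ∂(qbar q N)
      ≤ ∫ x, (√N / 2 * Zhat f x ^ 2 + (1 / 2) / √N) ∂(qbar q N) :=
        integral_mono (hZ.integrable (by norm_num)).abs
          ((h2i.const_mul _).add (integrable_const _)) hb
    _ = _ := by
        rw [integral_add (h2i.const_mul _) (integrable_const _), integral_const_mul, hvar]
        simp only [integral_const, probReal_univ, one_smul]
        nth_rewrite 2 [← hss]
        field_simp

end PIMH

/-! ### Pathwise analysis of the coupling, and the law of repeated rejection. -/

namespace PIMH

variable {X : Type*} {N : ℕ}

/-- The proposals and uniform draws which the state `x` rejects. -/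
def rejection (w : X → ℝ) (x : Fin N → X) : Set ((Fin N → X) × ℝ) :=
  {v | Zhat w v.1 / Zhat w x ≤ v.2}

/-- The draws for which the initial state rejects `y₀` and the first `k` further proposals. -/
def rejections (w : X → ℝ) (N k : ℕ) : Set (Draws X N) :=
  {d | (d.2.1, d.2.2.1) ∈ rejection w d.1 ∧ ∀ j < k, d.2.2.2 j ∈ rejection w d.1}

/-- The draws with positive weights and uniforms below one. -/
def regularDraws (w : X → ℝ) (N : ℕ) : Set (Draws X N) :=
  {d | 0 < Zhat w d.1 ∧ 0 < Zhat w d.2.1 ∧ d.2.2.1 < 1 ∧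
    ∀ n, 0 < Zhat w (d.2.2.2 n).1 ∧ (d.2.2.2 n).2 < 1}

theorem step_of_mem_rejection {w : X → ℝ} {x xs : Fin N → X} {u : ℝ}
    (h : (xs, u) ∈ rejection w x) : step w x xs u = x :=
  if_neg (not_lt.2 h)

theorem step_of_notMem_rejection {w : X → ℝ} {x xs : Fin N → X} {u : ℝ}
    (h : (xs, u) ∉ rejection w x) : step w x xs u = xs :=
  if_pos (not_le.1 h)

theorem Zhat_le_of_mem_rejection {w : X → ℝ} {x xs : Fin N → X} {u : ℝ}
    (hx : 0 < Zhat w x) (hu : u < 1) (h : (xs, u) ∈ rejection w x) :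
    Zhat w xs ≤ Zhat w x :=
  (div_le_one hx).1 (le_trans h hu.le)

/-- As long as the chains have not met, the leading chain has rejected every proposal and has a
weight at least as large as that of the other one. -/
theorem mem_rejections_of_not_met {w : X → ℝ} {d : Draws X N} (hd : d ∈ regularDraws w N) (k : ℕ)
    (h : ∀ n ≤ k, (lagChain w d n).1 ≠ (lagChain w d n).2) :
    d ∈ rejections w N k ∧ (lagChain w d k).1 = d.1 ∧ 0 < Zhat w (lagChain w d k).2 ∧
      Zhat w (lagChain w d k).2 ≤ Zhat w d.1 := by
  obtain ⟨hx, hy, hu, hv⟩ := hd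
  induction k with
  | zero =>
    have hr : (d.2.1, d.2.2.1) ∈ rejection w d.1 := by
      by_contra hr
      exact h 0 le_rfl (step_of_notMem_rejection hr)
    exact ⟨⟨hr, by simp⟩, step_of_mem_rejection hr, hy, Zhat_le_of_mem_rejection hx hu hr⟩
  | succ k ih =>
    obtain ⟨⟨hr0, hr⟩, h1, h2, h3⟩ := ih fun n hn => h n (hn.trans k.le_succ)
    obtain ⟨hv1, hv2⟩ := hv k
    have hk := h (k + 1) le_rfl
    simp only [lagChain, coupledStep] at hk ⊢
    rw [h1] at hk ⊢
    -- The trailing chain has the smaller `Zhat`, hence the larger acceptance ratio: if the leader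
    -- accepted, both would move to the same state.
    have hrk : d.2.2.2 k ∈ rejection w d.1 := by
      by_contra hrk
      apply hk
      rw [step_of_notMem_rejection hrk, step_of_notMem_rejection]
      intro hc
      exact hrk ((div_le_div_of_nonneg_left hv1.le h2 h3).trans hc)
    refine ⟨⟨hr0, fun j hj => ?_⟩, step_of_mem_rejection hrk, ?_⟩
    · rcases Nat.lt_succ_iff_lt_or_eq.1 hj with hj | rfl
      exacts [hr j hj, hrk]
    · by_cases hc : ((d.2.2.2 k).1, (d.2.2.2 k).2) ∈ rejection w (lagChain w d k).2
      · rw [step_of_mem_rejection hc]; exact ⟨h2, h3⟩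
      -- A proposal rejected by the leader with a uniform below one has no larger `Zhat`, so the
      -- ordering survives.
      · rw [step_of_notMem_rejection hc]
        exact ⟨hv1, Zhat_le_of_mem_rejection hx hv2 hrk⟩

theorem mem_rejections_of_lt_meetingTime {w : X → ℝ} {d : Draws X N}
    (hd : d ∈ regularDraws w N) {k : ℕ} (h : ((k + 1 : ℕ) : ℕ∞) < meetingTime w d) :
    d ∈ rejections w N k := by
  refine (mem_rejections_of_not_met hd k fun n hn hmet => ?_).1
  have h1 : meetingTime w d ≤ ((n + 1 : ℕ) : ℕ∞) := sInf_le ⟨n, rfl, hmet⟩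
  have h2 : ((n + 1 : ℕ) : ℕ∞) ≤ ((k + 1 : ℕ) : ℕ∞) := by exact_mod_cast Nat.succ_le_succ hn
  exact absurd h (not_lt.2 (h1.trans h2))

theorem toENNReal_eq_tsum_indicator (a : ℕ∞) :
    (a : ℝ≥0∞) = ∑' t : ℕ, if (t : ℕ∞) < a then 1 else 0 := by
  cases a with
  | top => simp
  | coe n =>
    rw [tsum_eq_sum (s := Finset.range n)]
    · rw [Finset.sum_congr rfl fun t ht => if_pos (by simpa using ht)]
      simp
    · intro t ht
      simpa using ht

/-- The leading `1` covers `t = 0` in the layer-cake sum; index `k` corresponds to `t = k + 1`. -/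
theorem meetingTime_le_tsum_indicator {w : X → ℝ} {d : Draws X N} (hd : d ∈ regularDraws w N) :
    (meetingTime w d : ℝ≥0∞) ≤
      1 + ∑' k : ℕ, (rejections w N k).indicator (fun _ => (1 : ℝ≥0∞)) d := by
  rw [toENNReal_eq_tsum_indicator, tsum_eq_zero_add' ENNReal.summable]
  refine add_le_add (by split_ifs <;> simp) (ENNReal.tsum_le_tsum fun k => ?_)
  split_ifs with h
  · rw [Set.indicator_of_mem (mem_rejections_of_lt_meetingTime hd h)]
  · exact zero_le

variable [MeasurableSpace X]

theorem measurableSet_rejection {w : X → ℝ} (hw : Measurable w) (x : Fin N → X) :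
    MeasurableSet (rejection w x) := by
  unfold rejection
  exact measurableSet_le (by fun_prop) (by fun_prop)

theorem measurableSet_rejections {w : X → ℝ} (hw : Measurable w) (k : ℕ) :
    MeasurableSet (rejections w N k) := by
  have h1 : MeasurableSet {d : Draws X N | Zhat w d.2.1 / Zhat w d.1 ≤ d.2.2.1} :=
    measurableSet_le (by fun_prop) (by fun_prop)
  have h2 (j : ℕ) :
      MeasurableSet {d : Draws X N | j < k → Zhat w (d.2.2.2 j).1 / Zhat w d.1 ≤ (d.2.2.2 j).2} :=
    (MeasurableSet.const _).imp (measurableSet_le (by fun_prop) (by fun_prop))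
  convert h1.inter (MeasurableSet.iInter h2) using 1
  ext d
  simp [rejections, rejection]

theorem unif_Ici_le (a : ℝ) : unif (Set.Ici a) ≤ ENNReal.ofReal (1 - a) := by
  unfold unif
  rw [Measure.restrict_apply measurableSet_Ici, ← Real.volume_Icc]
  exact measure_mono fun u hu => ⟨hu.1, hu.2.2.le⟩

theorem prod_unif_rejection_le {q : Measure X} {w : X → ℝ} (hw : Measurable w) (x : Fin N → X) :
    (qbar q N).prod unif (rejection w x) ≤
      ∫⁻ xs, ENNReal.ofReal (1 - Zhat w xs / Zhat w x) ∂(qbar q N) := by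
  rw [Measure.prod_apply (measurableSet_rejection hw x)]
  exact lintegral_mono fun xs => unif_Ici_le _

variable {q : Measure X} [IsProbabilityMeasure q]

theorem ae_qbar_of_ae {P : X → Prop} (h : ∀ᵐ y ∂q, P y) :
    ∀ᵐ x ∂(qbar q N), ∀ n, P (x n) :=
  ae_all_iff.2 fun n => (measurePreserving_eval_qbar q n).quasiMeasurePreserving.ae h

theorem ae_Zhat_pos (hN : 1 ≤ N) {w : X → ℝ} (hpos : ∀ᵐ x ∂q, 0 < w x) :
    ∀ᵐ x ∂(qbar q N), 0 < Zhat w x := by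
  have : Nonempty (Fin N) := ⟨⟨0, hN⟩⟩
  filter_upwards [ae_qbar_of_ae hpos] with x hx
  exact mul_pos (by positivity) (Finset.sum_pos (fun n _ => hx n) Finset.univ_nonempty)

theorem ae_unif_lt_one : ∀ᵐ u ∂unif, u < 1 := by
  unfold unif
  filter_upwards [ae_restrict_mem measurableSet_Ioo] with u hu using hu.2

theorem ae_mem_regularDraws (hN : 1 ≤ N) {w : X → ℝ} (hpos : ∀ᵐ x ∂q, 0 < w x) :
    ∀ᵐ d ∂(drawLaw q N), d ∈ regularDraws w N := by
  have hZ := ae_Zhat_pos hN hpos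
  have hv : ∀ᵐ v ∂((qbar q N).prod unif), 0 < Zhat w v.1 ∧ v.2 < 1 :=
    (Measure.quasiMeasurePreserving_fst.ae hZ).and
      (Measure.quasiMeasurePreserving_snd.ae ae_unif_lt_one)
  have hs : ∀ᵐ s ∂(Measure.infinitePi fun _ : ℕ => (qbar q N).prod unif),
      ∀ n, 0 < Zhat w (s n).1 ∧ (s n).2 < 1 :=
    ae_all_iff.2 fun n => (measurePreserving_eval_infinitePi
      (fun _ : ℕ => (qbar q N).prod unif) n).quasiMeasurePreserving.ae hv
  have h3 := (Measure.quasiMeasurePreserving_fst (μ := unif)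
    (ν := Measure.infinitePi fun _ : ℕ => (qbar q N).prod unif)).ae ae_unif_lt_one
  have h4 := (Measure.quasiMeasurePreserving_snd (μ := unif)
    (ν := Measure.infinitePi fun _ : ℕ => (qbar q N).prod unif)).ae hs
  have h5 := (Measure.quasiMeasurePreserving_fst (μ := qbar q N) (ν := unif.prod
    (Measure.infinitePi fun _ : ℕ => (qbar q N).prod unif))).ae hZ
  have h6 := (Measure.quasiMeasurePreserving_snd (μ := qbar q N) (ν := unif.prod
    (Measure.infinitePi fun _ : ℕ => (qbar q N).prod unif))).ae (h3.and h4)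
  exact (Measure.quasiMeasurePreserving_fst.ae hZ).and
    (Measure.quasiMeasurePreserving_snd.ae (h5.and h6))

/-- Given `x₀`, the pairs of proposal and uniform are i.i.d.; the exponent is `k + 1` because `y₀`
is itself the first proposal. -/
theorem drawLaw_rejections {w : X → ℝ} (hw : Measurable w) (k : ℕ) :
    drawLaw q N (rejections w N k) =
      ∫⁻ x, ((qbar q N).prod unif (rejection w x)) ^ (k + 1) ∂(qbar q N) := by
  unfold drawLaw
  rw [Measure.prod_apply (measurableSet_rejections hw k)]
  refine lintegral_congr fun x => ?_
  have hR := measurableSet_rejection hw x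
  have hS : MeasurableSet
      (Set.pi (Finset.range k : Set ℕ) fun _ => rejection w x) :=
    MeasurableSet.pi (Finset.range k).countable_toSet fun _ _ => hR
  have hset : Prod.mk x ⁻¹' rejections w N k = MeasurableEquiv.prodAssoc.symm ⁻¹'
      (rejection w x ×ˢ Set.pi (Finset.range k : Set ℕ) fun _ => rejection w x) := by
    ext ⟨y, u, s⟩
    simp [rejections, MeasurableEquiv.prodAssoc]
  rw [hset, ← Measure.prodAssoc_prod, MeasurableEquiv.map_apply, ← Set.preimage_comp,
    MeasurableEquiv.symm_comp_self, Set.preimage_id, Measure.prod_prod,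
    Measure.infinitePi_pi _ fun _ _ => hR]
  simp [pow_succ']

end PIMH

/-! ### Bounds on the rejection probability and on its powers. -/

namespace PIMH

/-- Combines `1 - y ≤ exp (-y)` with `z ≤ exp z` at `z = t * y / p`. The price of decay `t ^ (-p)`
is `y ^ (-p)`, which for `y = c / Zhat` is a `p`-th moment. -/
theorem one_sub_pow_le {y p : ℝ} (hy : 0 < y) (hy1 : y ≤ 1) (hp : 0 < p) {t : ℕ} (ht : 1 ≤ t) :
    (1 - y) ^ t ≤ (p / y) ^ p / (t : ℝ) ^ p := by
  have ht' : (0 : ℝ) < t := by exact_mod_cast ht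
  have h1 : (1 - y) ^ t ≤ Real.exp (-(t * y)) := by
    calc (1 - y) ^ t ≤ Real.exp (-y) ^ t :=
          pow_le_pow_left₀ (by linarith) (Real.one_sub_le_exp_neg y) t
      _ = Real.exp (-(t * y)) := by rw [← Real.exp_nat_mul]; congr 1; ring
  have h2 : (t * y / p) ^ p ≤ Real.exp (t * y) := by
    calc (t * y / p) ^ p ≤ Real.exp (t * y / p) ^ p := by
          refine Real.rpow_le_rpow (by positivity) ?_ hp.le
          linarith [Real.add_one_le_exp (t * y / p)]
      _ = Real.exp (t * y) := by rw [← Real.exp_mul]; congr 1; field_simp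
  refine h1.trans ?_
  rw [← Real.div_rpow (by positivity) (by positivity), Real.exp_neg]
  have h3 : p / y / t = (t * y / p)⁻¹ := by field_simp
  rw [h3, Real.inv_rpow (by positivity)]
  exact inv_anti₀ (by positivity) h2

variable {X : Type*} {N : ℕ} [MeasurableSpace X] {q : Measure X} [IsProbabilityMeasure q]

/-- Truncating the proposal weights at one and raising the denominator to at least one keeps the
ratio at most one, so the positive part in the rejection probability disappears and the expectation
is linear. -/
theorem prod_unif_rejection_le_one_sub (hN : 1 ≤ N) {w : X → ℝ} (hw : Measurable w)
    (hpos : ∀ᵐ x ∂q, 0 < w x) {x : Fin N → X} (hx : 0 < Zhat w x) :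
    (qbar q N).prod unif (rejection w x) ≤
      ENNReal.ofReal (1 - (∫ y, min (w y) 1 ∂q) / max (Zhat w x) 1) := by
  have hM : 0 < max (Zhat w x) 1 := lt_max_of_lt_left hx
  have hi : Integrable (fun y => min (w y) 1) q := by
    refine Integrable.of_bound (Measurable.aestronglyMeasurable (by fun_prop)) 1 ?_
    filter_upwards [hpos] with y hy
    rw [Real.norm_eq_abs, abs_of_pos (lt_min hy one_pos)]
    exact min_le_right _ _
  have hle : ∀ xs : Fin N → X, Zhat (fun y => min (w y) 1) xs ≤ 1 := fun xs => by
    have : Nonempty (Fin N) := ⟨⟨0, hN⟩⟩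
    have hN' : (N : ℝ) ≠ 0 := by positivity
    calc Zhat (fun y => min (w y) 1) xs ≤ Zhat (fun _ => 1) xs :=
          Zhat_mono fun n => min_le_right _ _
      _ = 1 := by simp [Zhat, hN']
  have hZi := (integrable_Zhat (N := N) hi).div_const (max (Zhat w x) 1)
  rw [← integral_Zhat hN hi, ← integral_div]
  have h1 : 1 - ∫ xs, Zhat (fun y => min (w y) 1) xs / max (Zhat w x) 1 ∂(qbar q N) =
      ∫ xs, (1 - Zhat (fun y => min (w y) 1) xs / max (Zhat w x) 1) ∂(qbar q N) := by
    rw [integral_sub (integrable_const _) hZi]; simp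
  have hfi : Integrable
      (fun xs => 1 - Zhat (fun y => min (w y) 1) xs / max (Zhat w x) 1) (qbar q N) :=
    (integrable_const _).sub hZi
  rw [h1, ofReal_integral_eq_lintegral_ofReal hfi]
  · refine (prod_unif_rejection_le hw x).trans (lintegral_mono_ae ?_)
    filter_upwards [ae_qbar_of_ae hpos] with xs hxs
    refine ENNReal.ofReal_le_ofReal (sub_le_sub_left ?_ 1)
    exact div_le_div₀ (Zhat_nonneg fun n => (hxs n).le) (Zhat_mono fun n => min_le_left _ _) hx
      (le_max_left _ _)
  · refine ae_of_all _ fun xs => sub_nonneg.2 ((div_le_one hM).2 ((hle xs).trans (le_max_right _ _)))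

/-- The expected rejection probability is controlled by the mean absolute error of `Zhat`. -/
theorem lintegral_rejection_le (hN : 1 ≤ N) {w : X → ℝ} (hw : Measurable w)
    (hpos : ∀ᵐ x ∂q, 0 < w x) (hi : Integrable w q) :
    ∫⁻ x, (qbar q N).prod unif (rejection w x) ∂(qbar q N) ≤
      ENNReal.ofReal (4 * ∫ x, |Zhat w x - 1| ∂(qbar q N)) := by
  have hZi : Integrable (fun x => |Zhat w x - 1|) (qbar q N) :=
    ((integrable_Zhat hi).sub (integrable_const 1)).abs
  set e := ∫ x, |Zhat w x - 1| ∂(qbar q N) with he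
  have he0 : 0 ≤ e := integral_nonneg fun x => abs_nonneg _
  have h1 : ∀ᵐ x ∂(qbar q N), (qbar q N).prod unif (rejection w x) ≤
      ENNReal.ofReal (2 * |Zhat w x - 1| + 2 * e) := by
    filter_upwards [ae_Zhat_pos hN hpos] with x hx
    refine (prod_unif_rejection_le hw x).trans ?_
    have h2 : 2 * |Zhat w x - 1| + 2 * e =
        ∫ xs, (2 * |Zhat w x - 1| + 2 * |Zhat w xs - 1|) ∂(qbar q N) := by
      rw [integral_add (integrable_const _) (hZi.const_mul _), integral_const_mul 2 fun xs =>
        |Zhat w xs - 1|, ← he]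
      simp
    have h2i : Integrable (fun xs => 2 * |Zhat w x - 1| + 2 * |Zhat w xs - 1|) (qbar q N) :=
      (integrable_const _).add (hZi.const_mul _)
    rw [h2, ofReal_integral_eq_lintegral_ofReal h2i (ae_of_all _ fun xs => by positivity)]
    refine lintegral_mono_ae ?_
    filter_upwards [ae_Zhat_pos hN hpos] with xs hxs
    refine ENNReal.ofReal_le_ofReal ?_
    -- Below `1 / 2`, `2 * |Zhat w x - 1|` already exceeds any probability; above, dividing by `Zhat
    -- w x` costs at most a factor 2.
    rcases le_total (Zhat w x) (1 / 2) with h | h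
    · have h3 : 0 ≤ Zhat w xs / Zhat w x := by positivity
      have h4 := neg_abs_le (Zhat w x - 1)
      have h5 := abs_nonneg (Zhat w xs - 1)
      linarith
    · rw [one_sub_div hx.ne', div_le_iff₀ hx]
      have h4 := le_abs_self (Zhat w x - 1)
      have h5 := neg_abs_le (Zhat w xs - 1)
      have h6 : 0 ≤ |Zhat w x - 1| + |Zhat w xs - 1| := by positivity
      nlinarith
  refine (lintegral_mono_ae h1).trans ?_
  have h2i : Integrable (fun x => 2 * |Zhat w x - 1| + 2 * e) (qbar q N) :=
    (hZi.const_mul _).add (integrable_const _)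
  rw [← ofReal_integral_eq_lintegral_ofReal h2i (ae_of_all _ fun x => by positivity)]
  refine ENNReal.ofReal_le_ofReal (le_of_eq ?_)
  rw [integral_add (hZi.const_mul _) (integrable_const _), integral_const_mul, ← he]
  simp; ring

theorem drawLaw_rejections_le (hN : 1 ≤ N) {w : X → ℝ} (hw : Measurable w)
    (hpos : ∀ᵐ x ∂q, 0 < w x) (hi : Integrable w q) (hw1 : ∫ y, w y ∂q = 1)
    {p : ℝ} (hp : 2 ≤ p) (hmom : Integrable (fun y => |w y - 1| ^ p) q)
    {c : ℝ} (hc : c = ∫ y, min (w y) 1 ∂q) (hc0 : 0 < c) (hc1 : c ≤ 1) (k : ℕ) :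
    drawLaw q N (rejections w N k) ≤ ENNReal.ofReal
      ((2 * p / c) ^ p * (8 * (∫ x, |Zhat w x - 1| ∂(qbar q N)) +
        2 * (p - 1) * (∫ y, |w y - 1| ^ p ∂q) / N) / ((k + 1 : ℕ) : ℝ) ^ p) := by
  have ht : (0 : ℝ) < ((k + 1 : ℕ) : ℝ) := by positivity
  set t : ℝ := ((k + 1 : ℕ) : ℝ) with htdef
  set K : ℝ := (2 * p / c) ^ p with hK
  have hK0 : 0 ≤ K := by positivity
  have hKpow : (1 - c / 2) ^ (k + 1) ≤ K / t ^ p := by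
    have h := one_sub_pow_le (y := c / 2) (p := p) (by linarith) (by linarith) (by linarith)
      (Nat.le_add_left 1 k)
    rwa [show p / (c / 2) = 2 * p / c by field_simp] at h
  obtain ⟨hmi, hml⟩ := integrable_and_integral_posPart_rpow_le hN (hw.sub_const 1)
    (by rw [integral_sub hi (integrable_const _), hw1]; simp) hp hmom
  simp only [Zhat_sub_one hN] at hmi hml
  set D := 2 * (p - 1) * (∫ y, |w y - 1| ^ p ∂q) / N with hD
  set e := ∫ x, |Zhat w x - 1| ∂(qbar q N) with he
  have he0 : 0 ≤ e := integral_nonneg fun x => abs_nonneg _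
  set r : (Fin N → X) → ℝ≥0∞ := fun x => (qbar q N).prod unif (rejection w x) with hr
  have hpt : ∀ᵐ x ∂(qbar q N), r x ^ (k + 1) ≤ ENNReal.ofReal (2 * K / t ^ p) * r x +
      ENNReal.ofReal (K / t ^ p * max (Zhat w x - 1) 0 ^ p) := by
    filter_upwards [ae_Zhat_pos hN hpos] with x hx
    have h1 : r x ≤ ENNReal.ofReal (1 - c / max (Zhat w x) 1) := by
      rw [hc]; exact prod_unif_rejection_le_one_sub hN hw hpos hx
    -- For small `Zhat`, one factor `r x` is kept for its mean `O(1 / √N)`; for large `Zhat`, the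
    -- moment of the positive part takes over.
    rcases le_total (Zhat w x) 2 with h | h
    · refine le_add_right ?_
      rw [pow_succ]
      gcongr
      have h2 : 1 - c / max (Zhat w x) 1 ≤ 1 - c / 2 :=
        sub_le_sub_left (div_le_div_of_nonneg_left hc0.le (lt_max_of_lt_right one_pos)
          (max_le h one_le_two)) 1
      calc r x ^ k ≤ ENNReal.ofReal (1 - c / 2) ^ k := by
            gcongr; exact h1.trans (ENNReal.ofReal_le_ofReal h2)
        _ = ENNReal.ofReal ((1 - c / 2) ^ k) := (ENNReal.ofReal_pow (by linarith) k).symm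
        _ ≤ _ := by
          refine ENNReal.ofReal_le_ofReal ?_
          rw [mul_div_assoc]
          refine le_trans ?_ (mul_le_mul_of_nonneg_left hKpow zero_le_two)
          -- Since `1 - c / 2 ≥ 1 / 2`, restoring the factor given up costs at most 2; hence `2 *
          -- K`.
          rw [pow_succ]
          have h3 : 0 ≤ (1 - c / 2) ^ k := pow_nonneg (by linarith) k
          nlinarith
    · refine le_add_left ?_
      rw [max_eq_left (by linarith)] at h1
      rw [max_eq_left (by linarith : 0 ≤ Zhat w x - 1)]
      have hcz : c / Zhat w x ≤ 1 := (div_le_one hx).2 (by linarith)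
      calc r x ^ (k + 1) ≤ ENNReal.ofReal (1 - c / Zhat w x) ^ (k + 1) := by gcongr
        _ = ENNReal.ofReal ((1 - c / Zhat w x) ^ (k + 1)) :=
          (ENNReal.ofReal_pow (by linarith) _).symm
        _ ≤ _ := by
          refine ENNReal.ofReal_le_ofReal ?_
          refine (one_sub_pow_le (p := p) (by positivity) hcz (by linarith)
            (Nat.le_add_left 1 k)).trans ?_
          -- `Zhat ≥ 2` gives `Zhat ≤ 2 * (Zhat - 1)`, the source of the 2 in `K`.
          rw [div_mul_eq_mul_div, hK, ← Real.mul_rpow (by positivity) (by linarith)]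
          gcongr
          rw [div_div_eq_mul_div, div_mul_eq_mul_div]
          refine div_le_div_of_nonneg_right ?_ hc0.le
          nlinarith
  rw [drawLaw_rejections hw]
  refine (lintegral_mono_ae hpt).trans ?_
  have hmeas : Measurable fun x : Fin N → X => ENNReal.ofReal (K / t ^ p * max (Zhat w x - 1) 0 ^ p) := by
    fun_prop
  rw [lintegral_add_right _ hmeas, lintegral_const_mul' _ _ ENNReal.ofReal_ne_top,
    ← ofReal_integral_eq_lintegral_ofReal (hmi.const_mul _)
      (ae_of_all _ fun x => by positivity), integral_const_mul]
  calc ENNReal.ofReal (2 * K / t ^ p) * ∫⁻ x, r x ∂(qbar q N) +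
        ENNReal.ofReal (K / t ^ p * ∫ x, max (Zhat w x - 1) 0 ^ p ∂(qbar q N))
      ≤ ENNReal.ofReal (2 * K / t ^ p) * ENNReal.ofReal (4 * e) +
        ENNReal.ofReal (K / t ^ p * D) := by
        gcongr
        exact lintegral_rejection_le hN hw hpos hi
    _ = ENNReal.ofReal (2 * K / t ^ p * (4 * e) + K / t ^ p * D) := by
        have hm0 : 0 ≤ D := le_trans (integral_nonneg fun x => by positivity) hml
        rw [← ENNReal.ofReal_mul (by positivity), ← ENNReal.ofReal_add (by positivity)
          (by positivity)]
    _ = _ := by congr 1; ring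

end PIMH

/-! ### Uniform constants and the conclusion. -/

theorem mainTheorem8 {X : Type*} [MeasurableSpace X]
    (q π : Measure X) [IsProbabilityMeasure q] [IsProbabilityMeasure π]
    (hac : π ≪ q)
    (w : X → ℝ) (hw : Measurable w)
    (hwd : w =ᵐ[q] fun x => (π.rnDeriv q x).toReal)
    (hpos : ∀ᵐ x ∂q, 0 < w x)
    (p : ℝ) (hp : 2 ≤ p)
    (hmom : Integrable (fun x => w x ^ p) q) :
    ∃ C : ℝ, 0 < C ∧ ∀ N : ℕ, 1 ≤ N →
      (∀ t : ℕ, 1 ≤ t →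
        (PIMH.drawLaw q N).real {d | (t : ℕ∞) < PIMH.meetingTime w d}
          ≤ C / (√(N : ℝ) * (t : ℝ) ^ p)) ∧
      ∫⁻ d, (PIMH.meetingTime w d : ℝ≥0∞) ∂(PIMH.drawLaw q N)
        ≤ ENNReal.ofReal (1 + (C * ∑' t : ℕ, ((t + 1 : ℕ) : ℝ) ^ (-p)) / √(N : ℝ)) := by
  have hp0 : 0 < p := by linarith
  have hpE : ENNReal.ofReal p ≠ 0 := by simpa using hp0
  have hLp : MemLp w (ENNReal.ofReal p) q := by
    rw [← integrable_norm_rpow_iff hw.aestronglyMeasurable hpE ENNReal.ofReal_ne_top,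
      ENNReal.toReal_ofReal hp0.le]
    refine hmom.congr ?_
    filter_upwards [hpos] with x hx
    rw [Real.norm_eq_abs, abs_of_pos hx]
  have hLp1 : MemLp (fun y => w y - 1) (ENNReal.ofReal p) q := hLp.sub (memLp_const 1)
  have hL2 : MemLp (fun y => w y - 1) 2 q := hLp1.mono_exponent (by
    rw [← ENNReal.ofReal_ofNat]; exact ENNReal.ofReal_le_ofReal hp)
  have hcent : Integrable (fun y => |w y - 1| ^ p) q := by
    rw [← integrable_norm_rpow_iff hLp1.aestronglyMeasurable hpE ENNReal.ofReal_ne_top,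
      ENNReal.toReal_ofReal hp0.le] at hLp1
    exact hLp1
  have hi : Integrable w q := hLp.integrable (by
    rw [← ENNReal.ofReal_one]; exact ENNReal.ofReal_le_ofReal (by linarith))
  have hw1 : ∫ y, w y ∂q = 1 := by
    rw [integral_congr_ae hwd, Measure.integral_toReal_rnDeriv hac, probReal_univ]
  have hw0 : ∫ y, (w y - 1) ∂q = 0 := by
    rw [integral_sub hi (integrable_const _), hw1]; simp
  have hmi : Integrable (fun y => min (w y) 1) q := hi.inf (integrable_const 1)
  obtain ⟨c, hc⟩ : ∃ c, c = ∫ y, min (w y) 1 ∂q := ⟨_, rfl⟩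
  have hc0 : 0 < c := by
    have hnn : 0 ≤ᵐ[q] fun y => min (w y) 1 := by
      filter_upwards [hpos] with y hy using (lt_min hy one_pos).le
    rw [hc, integral_pos_iff_support_of_nonneg_ae hnn hmi]
    have : Function.support (fun y => min (w y) 1) =ᵐ[q] Set.univ := by
      filter_upwards [hpos] with y hy
      exact propext ⟨fun _ => trivial, fun _ => (lt_min hy one_pos).ne'⟩
    rw [measure_congr this]; simp
  have hc1 : c ≤ 1 := by
    rw [hc]
    exact (integral_mono hmi hi fun y => min_le_left _ _).trans_eq hw1
  set σ := (Var[fun y => w y - 1; q] + 1) / 2 with hσ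
  have hσ0 : 0 < σ := by
    have := variance_nonneg (fun y => w y - 1) q
    positivity
  set B := 2 * (p - 1) * ∫ y, |w y - 1| ^ p ∂q with hB
  have hB0 : 0 ≤ B := mul_nonneg (by linarith) (integral_nonneg fun y => by positivity)
  -- `σ` bounds `√N * E|Zhat - 1|`, and `B / N` is weakened to `B / √N`, so `C` does not depend on
  -- `N`.
  set C := (2 * p / c) ^ p * (8 * σ + B) with hC
  have hC0 : 0 < C := by positivity
  have htail (N : ℕ) (hN : 1 ≤ N) (k : ℕ) : PIMH.drawLaw q N (PIMH.rejections w N k) ≤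
      ENNReal.ofReal (C / (√(N : ℝ) * ((k + 1 : ℕ) : ℝ) ^ p)) := by
    have hN1 : (1 : ℝ) ≤ N := by exact_mod_cast hN
    have hs : 0 < √(N : ℝ) := Real.sqrt_pos.2 (by linarith)
    refine (PIMH.drawLaw_rejections_le hN hw hpos hi hw1 hp hcent hc hc0 hc1 k).trans
      (ENNReal.ofReal_le_ofReal ?_)
    have h1 := PIMH.integral_abs_Zhat_le hN hL2 hw0
    simp only [PIMH.Zhat_sub_one hN] at h1
    have h2 : B / N ≤ B / √(N : ℝ) :=
      div_le_div_of_nonneg_left hB0 hs (Real.sqrt_le_iff.2 ⟨by linarith, by nlinarith⟩)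
    have h3 : 8 * (∫ x, |PIMH.Zhat w x - 1| ∂PIMH.qbar q N) + B / N ≤ (8 * σ + B) / √(N : ℝ) := by
      rw [add_div, mul_div_assoc 8]
      exact add_le_add (mul_le_mul_of_nonneg_left h1 (by norm_num)) h2
    rw [← div_div, hC, mul_div_assoc ((2 * p / c) ^ p) (8 * σ + B)]
    refine div_le_div_of_nonneg_right (mul_le_mul_of_nonneg_left ?_ ?_) ?_
    · exact h3
    · positivity
    · positivity
  refine ⟨C, hC0, fun N hN => ⟨fun t ht => ?_, ?_⟩⟩
  · obtain ⟨k, rfl⟩ := Nat.exists_eq_add_of_le' ht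
    refine ENNReal.toReal_le_of_le_ofReal (by positivity) ((measure_mono_ae ?_).trans (htail N hN k))
    filter_upwards [PIMH.ae_mem_regularDraws hN hpos] with d hd hlt
    exact PIMH.mem_rejections_of_lt_meetingTime hd hlt
  · have hsum : Summable fun k : ℕ => ((k + 1 : ℕ) : ℝ) ^ (-p) :=
      (summable_nat_add_iff 1).2 (Real.summable_nat_rpow.2 (by linarith))
    calc ∫⁻ d, (PIMH.meetingTime w d : ℝ≥0∞) ∂(PIMH.drawLaw q N)
        ≤ ∫⁻ d, (1 + ∑' k : ℕ, (PIMH.rejections w N k).indicator (fun _ => (1 : ℝ≥0∞)) d)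
            ∂(PIMH.drawLaw q N) := by
          refine lintegral_mono_ae ?_
          filter_upwards [PIMH.ae_mem_regularDraws hN hpos] with d hd
          exact PIMH.meetingTime_le_tsum_indicator hd
      _ = 1 + ∑' k : ℕ, PIMH.drawLaw q N (PIMH.rejections w N k) := by
          rw [lintegral_add_left measurable_const, lintegral_tsum fun k =>
            (measurable_const.indicator (PIMH.measurableSet_rejections hw k)).aemeasurable]
          simp [lintegral_indicator (PIMH.measurableSet_rejections hw _)]
      _ ≤ 1 + ∑' k : ℕ, ENNReal.ofReal (C / √(N : ℝ) * ((k + 1 : ℕ) : ℝ) ^ (-p)) := by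
          gcongr with k
          refine (htail N hN k).trans (le_of_eq ?_)
          rw [Real.rpow_neg (by positivity), ← div_div, div_eq_mul_inv _ (_ ^ p)]
      _ = _ := by
          rw [← ENNReal.ofReal_tsum_of_nonneg (fun k => by positivity) (hsum.mul_left _),
            tsum_mul_left, ← ENNReal.ofReal_one,
            ← ENNReal.ofReal_add zero_le_one (mul_nonneg (by positivity)
              (tsum_nonneg fun k => by positivity))]
          congr 2; ring
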